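/- Let $n\ge 0$, let $\lambda_j\ge 0$ and $0\le\theta_j\le\lambda_j$ for $j=0,\dots,n-1$, and let $x$ be a random vector in $\mathbb{R}^n$ with independent components $x_j\sim\mathcal{N}(0,\lambda_j)$. An encoding is a stochastic map (Markov kernel) $x\mapsto\hat x$ from $\mathbb{R}^n$ to $\mathbb{R}^n$; its rate is the mutual information $I(\hat x;x)\in[0,\infty]$ in bits, and its distortion is $D=\mathbf{E}[\|x-\hat x\|^2]$. An encoding is called Gaussian-additive with error variances $\theta_j$ if, with $\Delta=\hat x-x$, the vectors $x$ and $\Delta$ are jointly Gaussian, $\Delta$ has zero mean, the triads $(\hat x_j,x_j,\Delta_j)$, $j=0,\dots,n-1$, are independent of each other, and each triad has covariance matrix $$\begin{pmatrix}\lambda_j-\theta_j&\lambda_j-\theta_j&0\\ \lambda_j-\theta_j&\lambda_j&-\theta_j\\ 0&-\theta_j&\theta_j\end{pmatrix}.$$ Then a Gaussian-additive encoding with error variances $\theta_j$ exists, and every such encoding satisfies $\mathbf{E}[(\hat x_j-x_j)^2]=\theta_j$ for all $j$ and has rate $$I(\hat x;x)=\frac12\sum_{j=0}^{n-1}\log_2\frac{\lambda_j}{\theta_j},$$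 where a term with $\theta_j=0<\lambda_j$ is read as $+\infty$ and a term with $\lambda_j=\theta_j=0$ as $0$. This rate is the minimum of $I(\hat x;x)$ over all encodings such that $\mathbf{E}[(\hat x_j-x_j)^2]=\theta_j$ for all $j$. Every encoding satisfying these constraints, in particular every Gaussian-additive one with error variances $\theta_j$, has distortion $D=\sum_{j=0}^{n-1}\theta_j$. -/

import Mathlib

open MeasureTheory ProbabilityTheory
open scoped ENNReal NNReal

namespace GaussRD

/-- Signal space: `ℝⁿ` with its Euclidean norm. -/
abbrev Vec (n : ℕ) : Type := EuclideanSpace ℝ (Fin n)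

/-- Mutual information `I(X; Y)` in bits: the Kullback-Leibler divergence (in nats) of the joint
law from the product of the marginal laws, divided by `log 2`. -/
noncomputable def mutualInfo {Ω A B : Type*} [MeasurableSpace Ω] [MeasurableSpace A]
    [MeasurableSpace B] (X : Ω → A) (Y : Ω → B) (P : Measure Ω) : ℝ≥0∞ :=
  InformationTheory.klDiv (P.map fun ω => (X ω, Y ω)) ((P.map X).prod (P.map Y))
    / ENNReal.ofReal (Real.log 2)

/-- The source law: independent components, the `j`-th of law `N(0, lam j)`. -/
structure IsGaussianSource {n : ℕ} (μ : Measure (Vec n)) (lam : Fin n → ℝ≥0) : Prop where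
  indep : iIndepFun (fun (j : Fin n) (x : Vec n) => x j) μ
  law : ∀ j, μ.map (fun x : Vec n => x j) = gaussianReal 0 (lam j)

/-! An encoding is a (Markov) kernel `κ`, the conditional law of the reconstruction `x̂` given the
source vector `x`. Under the joint law `μ ⊗ₘ κ` of `(x, x̂)` on `Vec n × Vec n`, the source vector
is `p.1` and the reconstruction is `p.2`. -/

/-- The rate `I(x̂; x)` of the encoding `κ` of the source `μ`, in bits. -/
noncomputable def rate {n : ℕ} (μ : Measure (Vec n)) (κ : Kernel (Vec n) (Vec n)) : ℝ≥0∞ :=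
  mutualInfo (fun p : Vec n × Vec n => p.2) (fun p : Vec n × Vec n => p.1) (μ ⊗ₘ κ)

/-- The mean-square error `E[(x̂_j - x_j)²]` of the `j`-th component (possibly infinite). -/
noncomputable def mse {n : ℕ} (μ : Measure (Vec n)) (κ : Kernel (Vec n) (Vec n)) (j : Fin n) :
    ℝ≥0∞ :=
  ∫⁻ p, ENNReal.ofReal ((p.2 j - p.1 j) ^ 2) ∂(μ ⊗ₘ κ)

/-- The distortion `D = E[‖x - x̂‖²]` (possibly infinite). -/
noncomputable def distortion {n : ℕ} (μ : Measure (Vec n)) (κ : Kernel (Vec n) (Vec n)) : ℝ≥0∞ :=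
  ∫⁻ p, ENNReal.ofReal (‖p.1 - p.2‖ ^ 2) ∂(μ ⊗ₘ κ)

/-- The triad `(x̂_j, x_j, Δ_j)` with `Δ = x̂ - x`, as a function of `p = (x, x̂)`. -/
def triad {n : ℕ} (j : Fin n) (p : Vec n × Vec n) : Fin 3 → ℝ :=
  ![p.2 j, p.1 j, p.2 j - p.1 j]

/-- `κ` is a Gaussian-additive encoding, with error variances `θ`, of the source `μ` whose
components have variances `lam`. -/
structure IsGaussianAdditive {n : ℕ} (μ : Measure (Vec n)) (κ : Kernel (Vec n) (Vec n))
    (lam θ : Fin n → ℝ≥0) : Prop where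
  /-- The source `x` and the error `Δ = x̂ - x` are jointly Gaussian. -/
  gaussian : HasGaussianLaw (fun p : Vec n × Vec n => (p.1, p.2 - p.1)) (μ ⊗ₘ κ)
  /-- The error has zero-mean components. -/
  zero_mean : ∀ j, ∫ p, (p.2 j - p.1 j) ∂(μ ⊗ₘ κ) = 0
  /-- The triads, and in particular the components of the error, are independent of each other. -/
  indep : iIndepFun (fun j : Fin n => triad j) (μ ⊗ₘ κ)
  /-- The covariance matrix of each triad. -/
  cov_triad : ∀ j,
    (Matrix.of fun a b : Fin 3 => cov[fun p => triad j p a, fun p => triad j p b; μ ⊗ₘ κ]) =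
      !![(lam j : ℝ) - θ j, (lam j : ℝ) - θ j, 0;
         (lam j : ℝ) - θ j, (lam j : ℝ), -(θ j : ℝ);
         0, -(θ j : ℝ), (θ j : ℝ)]

/-- `log₂ (a / b)` for `0 ≤ b ≤ a`, as an extended nonnegative number: it is `∞` for
`b = 0 < a`, and `0` for `a = b`, also where `a = b = 0`. -/
noncomputable def log2Ratio (a b : ℝ≥0) : ℝ≥0∞ :=
  if b = 0 then (if a = 0 then 0 else ⊤) else ENNReal.ofReal (Real.logb 2 ((a : ℝ) / b))

end GaussRD

/-! For a reconstruction `m` let `f(m, x)` be the sum over `j` of the log-likelihood ratios of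
`N(m_j, θ_j)` with respect to `N(0, λ_j)` (`sumLogRatio`). For each fixed `m` the weight `exp f(m,
·)` has integral 1 against the source law, hence `exp f` has integral 1 against the product of the
marginals of `(x̂, x)`, whatever the law of `x̂`. The Donsker-Varadhan inequality then bounds the
mutual information below by `E f(x̂, x)`. This expectation involves only `E (x̂_j - x_j)² = θ_j` and
`E x_j² = λ_j`; the quadratic terms cancel and `½ ∑ log (λ_j / θ_j)` nats remain
(`rate_lower_bound`).

Equality holds when the joint law has density `exp f`, that is, when `x` given `x̂ = m` has
independent components `N(m_j, θ_j)`. A Gaussian-additive encoding has this property: `x̂` and `Δ`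
are jointly Gaussian and uncorrelated, so `Δ` is independent of `x̂`, and `x = x̂ - Δ`
(`map_swap_eq_withDensity`).

If `θ_j = 0 < λ_j` for some `j`, the joint law is singular to the product of its marginals and both
sides are infinite (`rate_eq_top`). Components with `λ_j = 0` contribute nothing. Existence comes
from the forward channel `x̂_j = (1 - θ_j / λ_j) x_j + z_j` with independent Gaussian noise `z_j`.
-/

namespace GaussRD

/-! ### Divergence bounds from exponential densities. -/

section KullbackLeibler

variable {α : Type*} [MeasurableSpace α] {P Q : Measure α} {f : α → ℝ}

/-- The Donsker-Varadhan lower bound for a normalized exponential weight. -/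
lemma ofReal_integral_le_klDiv [IsProbabilityMeasure P] [IsProbabilityMeasure Q]
    (hf : Measurable f) (hfP : Integrable f P)
    (hfQ : ∫⁻ x, ENNReal.ofReal (Real.exp (f x)) ∂Q = 1) :
    ENNReal.ofReal (∫ x, f x ∂P) ≤ InformationTheory.klDiv P Q := by
  by_cases h : InformationTheory.klDiv P Q = ⊤
  · simp [h]
  obtain ⟨hac, hint⟩ := InformationTheory.klDiv_ne_top_iff.mp h
  have hexp : Integrable (fun x => Real.exp (f x)) Q := by
    refine ⟨by fun_prop, ?_⟩
    rw [hasFiniteIntegral_iff_ofReal (Filter.Eventually.of_forall fun x => (Real.exp_pos _).le),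
      hfQ]
    exact ENNReal.one_lt_top
  have hone : ∫ x, Real.exp (f x) ∂Q = 1 := by
    rw [integral_eq_lintegral_of_nonneg_ae
      (Filter.Eventually.of_forall fun x => (Real.exp_pos _).le) (by fun_prop), hfQ]
    rfl
  -- The divergence of `P` from `Q.tilted f` is nonnegative; as the normalizing constant is 1, its
  -- log-likelihood ratio is `llr P Q - f`.
  have := isProbabilityMeasure_tilted hexp
  have hnn := InformationTheory.integral_llr_add_sub_measure_univ_nonneg
    (hac.trans (absolutelyContinuous_tilted hexp)) (integrable_llr_tilted_right hac hfP hint hexp)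
  rw [integral_llr_tilted_right hac hfP hexp hint, hone] at hnn
  rw [InformationTheory.klDiv_of_ac_of_integrable hac hint]
  apply ENNReal.ofReal_le_ofReal
  simp only [probReal_univ, Real.log_one] at hnn ⊢
  linarith

lemma klDiv_of_eq_withDensity_exp [IsProbabilityMeasure P] [IsProbabilityMeasure Q]
    (hf : Measurable f) (hfP : Integrable f P)
    (hPQ : P = Q.withDensity fun x => ENNReal.ofReal (Real.exp (f x))) :
    InformationTheory.klDiv P Q = ENNReal.ofReal (∫ x, f x ∂P) := by
  have hac : P ≪ Q := hPQ ▸ withDensity_absolutelyContinuous _ _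
  have hd : P.rnDeriv Q =ᵐ[Q] fun x => ENNReal.ofReal (Real.exp (f x)) := by
    conv_lhs => rw [hPQ]
    exact Measure.rnDeriv_withDensity _ (by fun_prop)
  have hllr : llr P Q =ᵐ[P] f := by
    filter_upwards [hac.ae_le hd] with x hx
    rw [llr, hx, ENNReal.toReal_ofReal (Real.exp_pos _).le, Real.log_exp]
  rw [InformationTheory.klDiv_of_ac_of_integrable hac (hfP.congr hllr.symm),
    integral_congr_ae hllr]
  simp

end KullbackLeibler

/-! ### Gaussian log-likelihood ratios. -/

/-- The log-likelihood ratio of `N(m, t)` with respect to `N(0, l)`, and `0` if `t = 0`. -/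
noncomputable def logRatio (l t : ℝ≥0) (m x : ℝ) : ℝ :=
  if t = 0 then 0 else Real.log (l / t) / 2 - (x - m) ^ 2 / (2 * t) + x ^ 2 / (2 * l)

lemma measurable_logRatio (l t : ℝ≥0) : Measurable fun p : ℝ × ℝ => logRatio l t p.1 p.2 := by
  unfold logRatio
  split_ifs <;> fun_prop

lemma measurable_exp_logRatio (l t : ℝ≥0) (m : ℝ) :
    Measurable fun x => ENNReal.ofReal (Real.exp (logRatio l t m x)) :=
  (((measurable_logRatio l t).comp (measurable_prodMk_left (x := m))).exp).ennreal_ofReal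

/-- For `t = 0` the weight is 1, so the identity survives only where both laws are the point mass at
0. -/
lemma withDensity_exp_logRatio {l t : ℝ≥0} (htl : t ≤ l) {m : ℝ} (h : t ≠ 0 ∨ (l = 0 ∧ m = 0)) :
    (gaussianReal 0 l).withDensity (fun x => ENNReal.ofReal (Real.exp (logRatio l t m x)))
      = gaussianReal m t := by
  by_cases ht : t = 0
  · obtain ⟨rfl, rfl⟩ : l = 0 ∧ m = 0 := by tauto
    simp [logRatio, ht]
  have hl : l ≠ 0 := fun h0 => ht (le_antisymm (h0 ▸ htl) zero_le)
  have htp : (0 : ℝ) < t := by positivity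
  have hlp : (0 : ℝ) < l := by positivity
  rw [gaussianReal_of_var_ne_zero _ ht, gaussianReal_of_var_ne_zero _ hl,
    ← withDensity_mul _ (measurable_gaussianPDF _ _) (measurable_exp_logRatio _ _ _)]
  congr 1
  ext1 x
  simp only [Pi.mul_apply, gaussianPDF]
  rw [← ENNReal.ofReal_mul (gaussianPDFReal_nonneg _ _ _)]
  congr 1
  simp only [gaussianPDFReal, logRatio, if_neg ht]
  have hs : Real.exp (Real.log (l / t) / 2) = √l / √t := by
    rw [← Real.sqrt_div hlp.le, Real.sqrt_eq_rpow, Real.rpow_def_of_pos (by positivity)]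
    ring_nf
  rw [show Real.log (l / t) / 2 - (x - m) ^ 2 / (2 * t) + x ^ 2 / (2 * l)
    = Real.log (l / t) / 2 + (-(x - m) ^ 2 / (2 * t) + x ^ 2 / (2 * l)) by ring, Real.exp_add, hs,
    Real.exp_add, show -(x - 0) ^ 2 / (2 * (l : ℝ)) = -(x ^ 2 / (2 * l)) by ring, Real.exp_neg,
    Real.sqrt_mul (by positivity), Real.sqrt_mul (by positivity)]
  have := (Real.exp_pos (x ^ 2 / (2 * (l : ℝ)))).ne'
  have := (Real.sqrt_pos.mpr htp).ne'
  have := (Real.sqrt_pos.mpr hlp).ne'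
  field_simp
  rw [show 2 * (t : ℝ) * Real.pi = 2 * Real.pi * t by ring, Real.sqrt_mul (by positivity),
    Real.sqrt_mul (by positivity)]

/-- The value 0 of `logRatio` at `t = 0` keeps the normalization valid without any nondegeneracy
assumption. -/
lemma lintegral_exp_logRatio {l t : ℝ≥0} (htl : t ≤ l) (m : ℝ) :
    ∫⁻ x, ENNReal.ofReal (Real.exp (logRatio l t m x)) ∂(gaussianReal 0 l) = 1 := by
  by_cases ht : t = 0
  · simp [logRatio, ht]
  · have h := congrArg (fun ν => ν Set.univ) (withDensity_exp_logRatio htl (m := m) (.inl ht))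
    simpa [withDensity_apply] using h

/-- The sum over the components of the log-likelihood ratios of `N(m j, θ j)` with respect to
`N(0, lam j)`. -/
noncomputable def sumLogRatio {n : ℕ} (lam θ : Fin n → ℝ≥0) (m x : Vec n) : ℝ :=
  ∑ j, logRatio (lam j) (θ j) (m j) (x j)

variable {n : ℕ} {μ : Measure (Vec n)} {lam θ : Fin n → ℝ≥0}

lemma measurable_sumLogRatio (lam θ : Fin n → ℝ≥0) :
    Measurable fun p : Vec n × Vec n => sumLogRatio lam θ p.1 p.2 := by
  unfold sumLogRatio logRatio
  refine Finset.measurable_fun_sum _ fun j _ => ?_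
  split_ifs
  · exact measurable_const
  · fun_prop

lemma exp_sumLogRatio (m x : Vec n) :
    ENNReal.ofReal (Real.exp (sumLogRatio lam θ m x))
      = ∏ j, ENNReal.ofReal (Real.exp (logRatio (lam j) (θ j) (m j) (x j))) := by
  rw [sumLogRatio, Real.exp_sum, ENNReal.ofReal_prod_of_nonneg fun j _ => (Real.exp_pos _).le]

/-- Independence of the source components factors the integral over a box. The full box gives the
normalization; general boxes identify the weighted law in `withDensity_exp_sumLogRatio`. -/
lemma lintegral_prod_indicator_exp_sumLogRatio (hμ : IsGaussianSource μ lam) (m : Vec n)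
    {B : Fin n → Set ℝ} (hB : ∀ j, MeasurableSet (B j)) :
    ∫⁻ x in {x : Vec n | ∀ j, x j ∈ B j}, ENNReal.ofReal (Real.exp (sumLogRatio lam θ m x)) ∂μ
      = ∏ j, ∫⁻ x in B j, ENNReal.ofReal (Real.exp (logRatio (lam j) (θ j) (m j) x))
          ∂(gaussianReal 0 (lam j)) := by
  have hset : MeasurableSet {x : Vec n | ∀ j, x j ∈ B j} := by
    have : {x : Vec n | ∀ j, x j ∈ B j} = ⋂ j, (fun x : Vec n => x j) ⁻¹' B j := by ext; simp
    exact this ▸ MeasurableSet.iInter fun j => (hB j).preimage (by fun_prop)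
  let g : Fin n → ℝ → ℝ≥0∞ := fun j =>
    (B j).indicator fun x => ENNReal.ofReal (Real.exp (logRatio (lam j) (θ j) (m j) x))
  have hg : ∀ j, Measurable (g j) := fun j => (measurable_exp_logRatio _ _ _).indicator (hB j)
  have hprod : ∀ x : Vec n, {x : Vec n | ∀ j, x j ∈ B j}.indicator
      (fun x => ENNReal.ofReal (Real.exp (sumLogRatio lam θ m x))) x = ∏ j, g j (x j) := by
    intro x
    by_cases hx : ∀ j, x j ∈ B j
    · rw [Set.indicator_of_mem (by exact hx), exp_sumLogRatio]
      exact Finset.prod_congr rfl fun j _ => by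
        simp only [g, Set.indicator_of_mem (hx j)]
    · rw [Set.indicator_of_notMem (by exact hx)]
      push Not at hx
      obtain ⟨j, hj⟩ := hx
      exact (Finset.prod_eq_zero (Finset.mem_univ j) (Set.indicator_of_notMem hj _)).symm
  have hint : ∫⁻ x : Vec n, ∏ j, g j (x j) ∂μ = ∏ j, ∫⁻ x : Vec n, g j (x j) ∂μ :=
    lintegral_prod_eq_prod_lintegral_of_indepFun Finset.univ (fun j (x : Vec n) => g j (x j))
      (hμ.indep.comp g hg) fun j => (hg j).comp (by fun_prop)
  rw [← lintegral_indicator hset, lintegral_congr hprod, hint]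
  refine Finset.prod_congr rfl fun j _ => ?_
  rw [← lintegral_indicator (hB j), ← hμ.law j, lintegral_map (hg j) (by fun_prop)]

lemma lintegral_exp_sumLogRatio (hμ : IsGaussianSource μ lam) (hθ : ∀ j, θ j ≤ lam j)
    (m : Vec n) : ∫⁻ x, ENNReal.ofReal (Real.exp (sumLogRatio lam θ m x)) ∂μ = 1 := by
  have h := lintegral_prod_indicator_exp_sumLogRatio (θ := θ) hμ m
    (B := fun _ => Set.univ) fun _ => MeasurableSet.univ
  simpa [lintegral_exp_logRatio (hθ _)] using h

end GaussRD

/-! ### Lower bound on the rate, and the infinite case. -/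

namespace GaussRD

variable {n : ℕ} {μ : Measure (Vec n)} {κ : Kernel (Vec n) (Vec n)} {lam θ : Fin n → ℝ≥0}

lemma map_fst_compProd [IsProbabilityMeasure μ] [IsMarkovKernel κ] :
    (μ ⊗ₘ κ).map (fun p : Vec n × Vec n => p.1) = μ :=
  Measure.fst_compProd μ κ

lemma rate_eq [IsProbabilityMeasure μ] [IsMarkovKernel κ] :
    rate μ κ = InformationTheory.klDiv ((μ ⊗ₘ κ).map fun p => (p.2, p.1))
      (((μ ⊗ₘ κ).map fun p => p.2).prod μ) / ENNReal.ofReal (Real.log 2) := by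
  rw [rate, mutualInfo, map_fst_compProd]

lemma distortion_eq_sum_mse : distortion μ κ = ∑ j, mse μ κ j := by
  unfold distortion mse
  rw [← lintegral_finsetSum _ fun j _ => by fun_prop]
  refine lintegral_congr fun p => ?_
  rw [← ENNReal.ofReal_sum_of_nonneg fun j _ => sq_nonneg _, EuclideanSpace.real_norm_sq_eq]
  congr 1
  exact Finset.sum_congr rfl fun j _ => by simp only [PiLp.sub_apply]; ring

lemma integrable_sq_error {j : Fin n} (h : mse μ κ j = θ j) :
    Integrable (fun p : Vec n × Vec n => (p.2 j - p.1 j) ^ 2) (μ ⊗ₘ κ) := by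
  refine ⟨by fun_prop, ?_⟩
  rw [hasFiniteIntegral_iff_ofReal (Filter.Eventually.of_forall fun p => sq_nonneg _)]
  exact h.trans_lt ENNReal.coe_lt_top

lemma integral_sq_error {j : Fin n} (h : mse μ κ j = θ j) :
    ∫ p : Vec n × Vec n, (p.2 j - p.1 j) ^ 2 ∂(μ ⊗ₘ κ) = θ j := by
  rw [integral_eq_lintegral_of_nonneg_ae (Filter.Eventually.of_forall fun p => sq_nonneg _)
    (by fun_prop)]
  exact congrArg ENNReal.toReal h

lemma ae_eq_of_mse_eq_zero {j : Fin n} (h : mse μ κ j = 0) :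
    ∀ᵐ p ∂(μ ⊗ₘ κ), p.2 j = p.1 j := by
  rw [mse, lintegral_eq_zero_iff (by fun_prop)] at h
  filter_upwards [h] with p hp
  have : (p.2 j - p.1 j) ^ 2 ≤ 0 := ENNReal.ofReal_eq_zero.mp hp
  nlinarith [sq_nonneg (p.2 j - p.1 j), sub_eq_zero.mp (pow_eq_zero_iff two_ne_zero |>.mp
    (le_antisymm this (sq_nonneg _)))]

section Source

variable [IsProbabilityMeasure μ] [IsMarkovKernel κ]

lemma IsGaussianSource.map_compProd (hμ : IsGaussianSource μ lam) (j : Fin n) :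
    (μ ⊗ₘ κ).map (fun p : Vec n × Vec n => p.1 j) = gaussianReal 0 (lam j) := by
  rw [← hμ.law j]
  conv_rhs => rw [← map_fst_compProd (μ := μ) (κ := κ)]
  rw [Measure.map_map (by fun_prop) (by fun_prop)]
  rfl

lemma integrable_sq_gaussianReal (m : ℝ) (v : ℝ≥0) :
    Integrable (fun x : ℝ => x ^ 2) (gaussianReal m v) :=
  (memLp_id_gaussianReal' 2 (by norm_num)).integrable_sq

lemma integral_sq_gaussianReal (v : ℝ≥0) : ∫ x, x ^ 2 ∂(gaussianReal 0 v) = v := by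
  have h := variance_fun_id_gaussianReal (μ := 0) (v := v)
  rwa [variance_of_integral_eq_zero (by fun_prop) integral_id_gaussianReal] at h

lemma IsGaussianSource.integrable_sq (hμ : IsGaussianSource μ lam) (j : Fin n) :
    Integrable (fun p : Vec n × Vec n => (p.1 j) ^ 2) (μ ⊗ₘ κ) := by
  have h := integrable_sq_gaussianReal 0 (lam j)
  rw [← hμ.map_compProd (κ := κ) j] at h
  exact h.comp_measurable (by fun_prop)

lemma IsGaussianSource.integral_sq (hμ : IsGaussianSource μ lam) (j : Fin n) :
    ∫ p : Vec n × Vec n, (p.1 j) ^ 2 ∂(μ ⊗ₘ κ) = lam j := by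
  have h := integral_sq_gaussianReal (lam j)
  rwa [← hμ.map_compProd (κ := κ) j, integral_map (by fun_prop) (by fun_prop)] at h

lemma integrable_logRatio (hμ : IsGaussianSource μ lam) {j : Fin n} (h : mse μ κ j = θ j) :
    Integrable (fun p : Vec n × Vec n => logRatio (lam j) (θ j) (p.2 j) (p.1 j)) (μ ⊗ₘ κ) := by
  unfold logRatio
  split_ifs
  · exact integrable_const _
  · have h1 := ((integrable_sq_error h).div_const (2 * θ j))
    have h2 := ((hμ.integrable_sq (κ := κ) j).div_const (2 * lam j))
    refine (((integrable_const (Real.log (lam j / θ j) / 2)).sub h1).add h2).congr ?_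
    refine Filter.Eventually.of_forall fun p => ?_
    simp only [Pi.add_apply, Pi.sub_apply]
    ring

/-- The quadratic terms contribute `-1/2` and `+1/2`. Only second moments enter, so the value is the
same for every encoding with these errors. -/
lemma integral_logRatio (hμ : IsGaussianSource μ lam) {j : Fin n} (hθ : θ j ≤ lam j)
    (h : mse μ κ j = θ j) :
    ∫ p : Vec n × Vec n, logRatio (lam j) (θ j) (p.2 j) (p.1 j) ∂(μ ⊗ₘ κ)
      = if θ j = 0 then 0 else Real.log (lam j / θ j) / 2 := by
  unfold logRatio
  split_ifs with ht
  · simp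
  · have hl : lam j ≠ 0 := fun h0 => ht (le_antisymm (h0 ▸ hθ) zero_le)
    have h1 := ((integrable_sq_error h).div_const (2 * θ j))
    have h2 := ((hμ.integrable_sq (κ := κ) j).div_const (2 * lam j))
    have e1 := integral_sq_error h
    have e2 := hμ.integral_sq (κ := κ) j
    have hc : ∀ p : Vec n × Vec n, (p.1 j - p.2 j) ^ 2 = (p.2 j - p.1 j) ^ 2 := fun p => by ring
    simp only [hc]
    have h3 : Integrable (fun p : Vec n × Vec n =>
        Real.log (lam j / θ j) / 2 - (p.2 j - p.1 j) ^ 2 / (2 * θ j)) (μ ⊗ₘ κ) :=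
      (integrable_const _).sub h1
    rw [integral_add h3 h2, integral_sub (integrable_const _) h1,
      integral_div (2 * (θ j : ℝ)), integral_div (2 * (lam j : ℝ)), e1, e2]
    have : (θ j : ℝ) ≠ 0 := by exact_mod_cast ht
    have : (lam j : ℝ) ≠ 0 := by exact_mod_cast hl
    simp
    field_simp
    ring

lemma integrable_sumLogRatio_map (hμ : IsGaussianSource μ lam) (h : ∀ j, mse μ κ j = θ j) :
    Integrable (fun q : Vec n × Vec n => sumLogRatio lam θ q.1 q.2)
      ((μ ⊗ₘ κ).map fun p => (p.2, p.1)) := by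
  rw [integrable_map_measure (measurable_sumLogRatio lam θ).aestronglyMeasurable (by fun_prop)]
  unfold sumLogRatio Function.comp
  exact integrable_finsetSum _ fun j _ => integrable_logRatio hμ (h j)

/-- The rate in nats of a Gaussian-additive encoding with error variances `θ`. -/
noncomputable def gaussianRate (lam θ : Fin n → ℝ≥0) : ℝ :=
  ∑ j, if θ j = 0 then 0 else Real.log (lam j / θ j) / 2

lemma integral_sumLogRatio_map (hμ : IsGaussianSource μ lam) (hθ : ∀ j, θ j ≤ lam j)
    (h : ∀ j, mse μ κ j = θ j) :
    ∫ q : Vec n × Vec n, sumLogRatio lam θ q.1 q.2 ∂((μ ⊗ₘ κ).map fun p => (p.2, p.1))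
      = gaussianRate lam θ := by
  rw [integral_map (by fun_prop) (measurable_sumLogRatio lam θ).aestronglyMeasurable]
  unfold sumLogRatio
  rw [integral_finsetSum _ fun j _ => integrable_logRatio hμ (h j)]
  exact Finset.sum_congr rfl fun j _ => integral_logRatio hμ (hθ j) (h j)

lemma ofReal_gaussianRate (hθ : ∀ j, θ j ≤ lam j) (h0 : ∀ j, θ j = 0 → lam j = 0) :
    ENNReal.ofReal (gaussianRate lam θ) / ENNReal.ofReal (Real.log 2)
      = 1 / 2 * ∑ j, log2Ratio (lam j) (θ j) := by
  have hlog : ∀ j, θ j ≠ 0 → 0 ≤ Real.log (lam j / θ j) := by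
    intro j hj
    have : (0 : ℝ) < θ j := by positivity
    exact Real.log_nonneg ((one_le_div this).mpr (by exact_mod_cast hθ j))
  have h2 : 0 < Real.log 2 := Real.log_pos one_lt_two
  have hterm : ∀ j, log2Ratio (lam j) (θ j)
      = ENNReal.ofReal (if θ j = 0 then 0 else Real.logb 2 (lam j / θ j)) := by
    intro j
    unfold log2Ratio
    split_ifs with h h'
    · simp
    · exact absurd (h0 j h) h'
    · rfl
  have hhalf : (1 / 2 : ℝ≥0∞) = ENNReal.ofReal (1 / 2) := by
    rw [ENNReal.ofReal_div_of_pos two_pos]; simp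
  rw [Finset.sum_congr rfl fun j _ => hterm j, ← ENNReal.ofReal_sum_of_nonneg, hhalf,
    ← ENNReal.ofReal_mul (by norm_num), ← ENNReal.ofReal_div_of_pos h2, gaussianRate,
    Finset.sum_div, Finset.mul_sum]
  · congr 1
    refine Finset.sum_congr rfl fun j _ => ?_
    split_ifs
    · simp
    · rw [Real.logb]; ring
  · intro j _
    split_ifs with h
    · exact le_rfl
    · exact div_nonneg (hlog j h) h2.le

lemma rate_lower_bound (hμ : IsGaussianSource μ lam) (hθ : ∀ j, θ j ≤ lam j)
    (h0 : ∀ j, θ j = 0 → lam j = 0) (h : ∀ j, mse μ κ j = θ j) :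
    1 / 2 * ∑ j, log2Ratio (lam j) (θ j) ≤ rate μ κ := by
  have : IsProbabilityMeasure ((μ ⊗ₘ κ).map fun p => (p.2, p.1)) :=
    Measure.isProbabilityMeasure_map (by fun_prop)
  have : IsProbabilityMeasure ((μ ⊗ₘ κ).map fun p => p.2) :=
    Measure.isProbabilityMeasure_map (by fun_prop)
  rw [← ofReal_gaussianRate hθ h0, rate_eq, ← integral_sumLogRatio_map hμ hθ h]
  refine ENNReal.div_le_div_right (ofReal_integral_le_klDiv (measurable_sumLogRatio lam θ)
    (integrable_sumLogRatio_map hμ h) ?_) _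
  -- Tonelli with the reconstruction as outer variable: each inner integral over the source is 1.
  rw [lintegral_prod _ (measurable_sumLogRatio lam θ).exp.ennreal_ofReal.aemeasurable]
  simp [lintegral_exp_sumLogRatio hμ hθ]

/-- The joint law lives on `{x̂_j = x_j}`, which is null for the product of the marginals because
`N(0, λ_j)` has no atoms. Absolute continuity fails. -/
lemma rate_eq_top (hμ : IsGaussianSource μ lam) {j : Fin n} (hl : lam j ≠ 0)
    (h : mse μ κ j = 0) : rate μ κ = ⊤ := by
  have hmeas : MeasurableSet {q : Vec n × Vec n | q.1 j = q.2 j} :=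
    measurableSet_eq_fun (by fun_prop) (by fun_prop)
  have hprob : IsProbabilityMeasure ((μ ⊗ₘ κ).map fun p => (p.2, p.1)) :=
    Measure.isProbabilityMeasure_map (by fun_prop)
  rw [rate_eq, InformationTheory.klDiv_of_not_ac, ENNReal.top_div_of_ne_top ENNReal.ofReal_ne_top]
  intro hac
  have hQ : (((μ ⊗ₘ κ).map fun p => p.2).prod μ) {q : Vec n × Vec n | q.1 j = q.2 j} = 0 := by
    rw [Measure.prod_apply hmeas, lintegral_eq_zero_iff (measurable_measure_prodMk_left hmeas)]
    refine Filter.Eventually.of_forall fun a => ?_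
    have := nullSingletonClass_gaussianReal (μ := 0) hl
    have hs : gaussianReal 0 (lam j) {a j} = 0 := measure_singleton _
    rw [← hμ.law j, Measure.map_apply (by fun_prop) (measurableSet_singleton _)] at hs
    refine measure_mono_null (fun x hx => ?_) hs
    exact Eq.symm hx
  have hP : ∀ᵐ q : Vec n × Vec n ∂((μ ⊗ₘ κ).map fun p => (p.2, p.1)), q.1 j = q.2 j := by
    rw [ae_map_iff (by fun_prop) hmeas]
    exact ae_eq_of_mse_eq_zero h
  have hfalse : ∀ᵐ q : Vec n × Vec n ∂((μ ⊗ₘ κ).map fun p => (p.2, p.1)), False := by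
    filter_upwards [hP, measure_eq_zero_iff_ae_notMem.mp (hac hQ)] with q h1 h2 using h2 h1
  exact hprob.ne_zero _ (ae_eq_bot.mp (Filter.eventually_false_iff_eq_bot.mp hfalse))

lemma half_sum_log2Ratio_eq_top {j : Fin n} (hl : lam j ≠ 0) (ht : θ j = 0) :
    1 / 2 * ∑ j, log2Ratio (lam j) (θ j) = ⊤ := by
  have : ∑ j, log2Ratio (lam j) (θ j) = ⊤ :=
    ENNReal.sum_eq_top.mpr ⟨j, Finset.mem_univ j, by simp [log2Ratio, hl, ht]⟩
  rw [this, ENNReal.mul_top (by simp)]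

end Source

end GaussRD

/-! ### Rate of Gaussian-additive encodings. -/

namespace GaussRD

variable {n : ℕ} {μ : Measure (Vec n)} {κ : Kernel (Vec n) (Vec n)} {lam θ : Fin n → ℝ≥0}

/-- Two measures on `Vec n` with the same joint law of the components are equal. -/
lemma measure_ext_of_map_components {σ τ : Measure (Vec n)}
    (h : σ.map (fun x j => x j) = τ.map fun x j => x j) : σ = τ := by
  apply (MeasurableEquiv.toLp 2 (Fin n → ℝ)).symm.map_measurableEquiv_injective
  exact h

lemma withDensity_exp_sumLogRatio (hμ : IsGaussianSource μ lam) (hθ : ∀ j, θ j ≤ lam j)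
    {m : Vec n} (hm : ∀ j, θ j ≠ 0 ∨ (lam j = 0 ∧ m j = 0)) :
    (μ.withDensity fun x => ENNReal.ofReal (Real.exp (sumLogRatio lam θ m x))).map (fun x j => x j)
      = Measure.pi fun j => gaussianReal (m j) (θ j) := by
  refine (Measure.pi_eq fun B hB => ?_).symm
  have hset : (fun (x : Vec n) j => x j) ⁻¹' (Set.univ.pi B) = {x : Vec n | ∀ j, x j ∈ B j} := by
    ext; simp
  have hmeas : MeasurableSet {x : Vec n | ∀ j, x j ∈ B j} :=
    hset ▸ (MeasurableSet.univ_pi hB).preimage (by fun_prop)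
  rw [Measure.map_apply (by fun_prop) (MeasurableSet.univ_pi hB), hset, withDensity_apply _ hmeas,
    lintegral_prod_indicator_exp_sumLogRatio hμ m hB]
  refine Finset.prod_congr rfl fun j _ => ?_
  rw [← withDensity_exp_logRatio (hθ j) (hm j), withDensity_apply _ (hB j)]

namespace IsGaussianAdditive

lemma memLp_source (h : IsGaussianAdditive μ κ lam θ) (j : Fin n) :
    MemLp (fun p : Vec n × Vec n => p.1 j) 2 (μ ⊗ₘ κ) :=
  (h.gaussian.fst.map_fun (EuclideanSpace.proj j)).memLp_two

lemma hasGaussianLaw_error (h : IsGaussianAdditive μ κ lam θ) (j : Fin n) :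
    HasGaussianLaw (fun p : Vec n × Vec n => p.2 j - p.1 j) (μ ⊗ₘ κ) :=
  h.gaussian.snd.map_fun (EuclideanSpace.proj j)

lemma memLp_error (h : IsGaussianAdditive μ κ lam θ) (j : Fin n) :
    MemLp (fun p : Vec n × Vec n => p.2 j - p.1 j) 2 (μ ⊗ₘ κ) :=
  (h.hasGaussianLaw_error j).memLp_two

lemma memLp_reconstruction (h : IsGaussianAdditive μ κ lam θ) (j : Fin n) :
    MemLp (fun p : Vec n × Vec n => p.2 j) 2 (μ ⊗ₘ κ) := by
  have := (h.memLp_source j).add (h.memLp_error j)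
  refine this.ae_eq (Filter.Eventually.of_forall fun p => ?_)
  simp

lemma variance_error (h : IsGaussianAdditive μ κ lam θ) (j : Fin n) :
    Var[fun p : Vec n × Vec n => p.2 j - p.1 j; μ ⊗ₘ κ] = θ j := by
  rw [← covariance_self (h.hasGaussianLaw_error j).aemeasurable]
  have := congrFun (congrFun (h.cov_triad j) 2) 2
  simpa [triad] using this

/-- The diagonal case is an entry of the triad covariance matrix; the off-diagonal case is
independence of the triads. -/
lemma cov_reconstruction_error (h : IsGaussianAdditive μ κ lam θ) (i j : Fin n) :
    cov[fun p : Vec n × Vec n => p.2 i, fun p => p.2 j - p.1 j; μ ⊗ₘ κ] = 0 := by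
  by_cases hij : i = j
  · subst hij
    have := congrFun (congrFun (h.cov_triad i) 0) 2
    simpa [triad] using this
  · have hind : IndepFun (fun p : Vec n × Vec n => p.2 i) (fun p => p.2 j - p.1 j) (μ ⊗ₘ κ) :=
      (h.indep.indepFun hij).comp (measurable_pi_apply 0) (measurable_pi_apply 2)
    exact hind.covariance_eq_zero (h.memLp_reconstruction i) (h.memLp_error j)

lemma map_error (h : IsGaussianAdditive μ κ lam θ) (j : Fin n) :
    (μ ⊗ₘ κ).map (fun p : Vec n × Vec n => p.2 j - p.1 j) = gaussianReal 0 (θ j) := by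
  rw [(h.hasGaussianLaw_error j).map_eq_gaussianReal, h.variance_error, h.zero_mean]
  simp

lemma mse_eq (h : IsGaussianAdditive μ κ lam θ) (j : Fin n) : mse μ κ j = θ j := by
  have hv := h.variance_error j
  rw [variance_of_integral_eq_zero (h.hasGaussianLaw_error j).aemeasurable (h.zero_mean j)] at hv
  rw [mse, ← ofReal_integral_eq_lintegral_ofReal (h.memLp_error j).integrable_sq
    (Filter.Eventually.of_forall fun p => sq_nonneg _), hv]
  simp

/-- For jointly Gaussian vectors, vanishing cross-covariances suffice. -/
lemma indepFun_reconstruction_error (h : IsGaussianAdditive μ κ lam θ) :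
    IndepFun (fun p : Vec n × Vec n => p.2) (fun p => p.2 - p.1) (μ ⊗ₘ κ) := by
  let e := (PiLp.continuousLinearEquiv 2 ℝ fun _ : Fin n => ℝ).toContinuousLinearMap
  let L : Vec n × Vec n →L[ℝ] (Fin n → ℝ) × (Fin n → ℝ) :=
    (e ∘L (ContinuousLinearMap.fst ℝ _ _ + ContinuousLinearMap.snd ℝ _ _)).prod
      (e ∘L ContinuousLinearMap.snd ℝ _ _)
  have hG : HasGaussianLaw (fun p : Vec n × Vec n =>
      (fun i => p.2 i, fun j => p.2 j - p.1 j)) (μ ⊗ₘ κ) := by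
    refine (h.gaussian.map_fun L).congr (Filter.Eventually.of_forall fun p => ?_)
    ext j <;> simp [L, e]
  have hind := hG.indepFun_of_covariance_eval (X := fun i (p : Vec n × Vec n) => p.2 i)
    (Y := fun j (p : Vec n × Vec n) => p.2 j - p.1 j) h.cov_reconstruction_error
  exact hind.comp (MeasurableEquiv.toLp 2 (Fin n → ℝ)).measurable
    (MeasurableEquiv.toLp 2 (Fin n → ℝ)).measurable

lemma iIndepFun_error (h : IsGaussianAdditive μ κ lam θ) :
    iIndepFun (fun j (p : Vec n × Vec n) => p.2 j - p.1 j) (μ ⊗ₘ κ) :=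
  h.indep.comp (fun _ v => v 2) fun _ => measurable_pi_apply 2

/-- Since `x = x̂ - Δ` with `Δ` independent of `x̂`, this is the conditional law of the source given
`x̂ = m`. -/
lemma map_const_sub_error (h : IsGaussianAdditive μ κ lam θ) (m : Vec n) :
    (((μ ⊗ₘ κ).map fun p => p.2 - p.1).map fun d => m - d).map (fun x j => x j)
      = Measure.pi fun j => gaussianReal (m j) (θ j) := by
  have hind : iIndepFun (fun j (p : Vec n × Vec n) => m j - (p.2 j - p.1 j)) (μ ⊗ₘ κ) :=
    h.iIndepFun_error.comp (fun j d => m j - d) fun _ => by fun_prop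
  rw [Measure.map_map (by fun_prop) (by fun_prop), Measure.map_map (by fun_prop) (by fun_prop)]
  refine (hind.map_fun_eq_pi_map fun j => by fun_prop).trans ?_
  congr 1
  ext1 j
  have := Measure.map_map (μ := μ ⊗ₘ κ) (g := fun d : ℝ => m j - d)
    (f := fun p : Vec n × Vec n => p.2 j - p.1 j) (by fun_prop) (by fun_prop)
  rw [h.map_error, gaussianReal_map_const_sub, sub_zero] at this
  exact this.symm

variable [IsProbabilityMeasure μ] [IsMarkovKernel κ]

lemma ae_reconstruction_eq_zero (h : IsGaussianAdditive μ κ lam θ) (hμ : IsGaussianSource μ lam)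
    (hθ : ∀ j, θ j ≤ lam j) {j : Fin n} (hl : lam j = 0) : ∀ᵐ p ∂(μ ⊗ₘ κ), p.2 j = 0 := by
  have ht : mse μ κ j = 0 := by
    have ht : θ j = 0 := le_antisymm (hl ▸ hθ j) zero_le
    rw [h.mse_eq, ht, ENNReal.coe_zero]
  have hx : ∀ᵐ p ∂(μ ⊗ₘ κ), p.1 j = 0 := by
    have hlaw := hμ.map_compProd (κ := κ) j
    rw [hl, gaussianReal_zero_var] at hlaw
    have hd : ∀ᵐ x ∂((μ ⊗ₘ κ).map fun p : Vec n × Vec n => p.1 j), x = 0 := by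
      rw [hlaw, ae_dirac_eq]; rfl
    exact ae_of_ae_map (by fun_prop) hd
  filter_upwards [ae_eq_of_mse_eq_zero ht, hx] with p h1 h2 using h1.trans h2

/-- The joint law of reconstruction and source has the expected density with respect to the
product of the marginals. -/
lemma map_swap_eq_withDensity (h : IsGaussianAdditive μ κ lam θ) (hμ : IsGaussianSource μ lam)
    (hθ : ∀ j, θ j ≤ lam j) (h0 : ∀ j, θ j = 0 → lam j = 0) :
    (μ ⊗ₘ κ).map (fun p => (p.2, p.1)) = (((μ ⊗ₘ κ).map fun p => p.2).prod μ).withDensity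
      fun q => ENNReal.ofReal (Real.exp (sumLogRatio lam θ q.1 q.2)) := by
  have hd : Measurable fun q : Vec n × Vec n =>
      ENNReal.ofReal (Real.exp (sumLogRatio lam θ q.1 q.2)) :=
    (measurable_sumLogRatio lam θ).exp.ennreal_ofReal
  have : IsProbabilityMeasure ((μ ⊗ₘ κ).map fun p => p.2) :=
    Measure.isProbabilityMeasure_map (by fun_prop)
  have : IsProbabilityMeasure ((μ ⊗ₘ κ).map fun p => p.2 - p.1) :=
    Measure.isProbabilityMeasure_map (by fun_prop)
  have hprod := (indepFun_iff_map_prod_eq_prod_map_map (by fun_prop) (by fun_prop)).mp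
    h.indepFun_reconstruction_error
  have hmap : (μ ⊗ₘ κ).map (fun p => (p.2, p.1))
      = (((μ ⊗ₘ κ).map fun p => p.2).prod ((μ ⊗ₘ κ).map fun p => p.2 - p.1)).map
        fun q => (q.1, q.1 - q.2) := by
    rw [← hprod, Measure.map_map (by fun_prop) (by fun_prop)]
    congr 1
    ext1 p
    simp
  have hcond : ∀ᵐ m ∂((μ ⊗ₘ κ).map fun p => p.2),
      ((μ ⊗ₘ κ).map fun p => p.2 - p.1).map (fun d => m - d)
        = μ.withDensity fun x => ENNReal.ofReal (Real.exp (sumLogRatio lam θ m x)) := by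
    -- In degenerate coordinates the weight is 1, and the conditional law is the point mass at `m
    -- j`; they agree only because `m j = 0` almost surely.
    have hz : ∀ᵐ m : Vec n ∂((μ ⊗ₘ κ).map fun p => p.2), ∀ j, lam j = 0 → m j = 0 := by
      refine ae_all_iff.mpr fun j => ?_
      by_cases hl : lam j = 0
      · have hm : MeasurableSet {m : Vec n | m j = 0} :=
          (measurableSet_singleton (0 : ℝ)).preimage (by fun_prop)
        simp only [hl, forall_const]
        exact (ae_map_iff (by fun_prop) hm).mpr (h.ae_reconstruction_eq_zero hμ hθ hl)
      · simp [hl]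
    filter_upwards [hz] with m hm
    refine measure_ext_of_map_components ?_
    rw [h.map_const_sub_error, withDensity_exp_sumLogRatio hμ hθ]
    intro j
    by_cases ht : θ j = 0
    · exact .inr ⟨h0 j ht, hm j (h0 j ht)⟩
    · exact .inl ht
  rw [hmap]
  -- Both measures are integrated along sections `x̂ = m`, where `hcond` compares them.
  ext s hs
  have hs' : MeasurableSet ((fun q : Vec n × Vec n => (q.1, q.1 - q.2)) ⁻¹' s) :=
    hs.preimage (by fun_prop)
  rw [Measure.map_apply (by fun_prop) hs, Measure.prod_apply hs', withDensity_apply _ hs,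
    ← lintegral_indicator hs, lintegral_prod _ (hd.indicator hs).aemeasurable]
  refine lintegral_congr_ae ?_
  filter_upwards [hcond] with m hm
  have hsm : MeasurableSet (Prod.mk m ⁻¹' s) := measurable_prodMk_left hs
  have h1 := congrArg (fun ν => ν (Prod.mk m ⁻¹' s)) hm
  simp only [Measure.map_apply (by fun_prop : Measurable fun d => m - d) hsm,
    withDensity_apply _ hsm, ← lintegral_indicator hsm] at h1
  exact h1

lemma rate_eq (h : IsGaussianAdditive μ κ lam θ) (hμ : IsGaussianSource μ lam)
    (hθ : ∀ j, θ j ≤ lam j) : rate μ κ = 1 / 2 * ∑ j, log2Ratio (lam j) (θ j) := by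
  by_cases h0 : ∀ j, θ j = 0 → lam j = 0
  · have : IsProbabilityMeasure ((μ ⊗ₘ κ).map fun p => (p.2, p.1)) :=
      Measure.isProbabilityMeasure_map (by fun_prop)
    have : IsProbabilityMeasure ((μ ⊗ₘ κ).map fun p => p.2) :=
      Measure.isProbabilityMeasure_map (by fun_prop)
    rw [GaussRD.rate_eq, klDiv_of_eq_withDensity_exp (measurable_sumLogRatio lam θ)
      (integrable_sumLogRatio_map hμ h.mse_eq) (h.map_swap_eq_withDensity hμ hθ h0),
      integral_sumLogRatio_map hμ hθ h.mse_eq, ofReal_gaussianRate hθ h0]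
  · push Not at h0
    obtain ⟨j, ht, hl⟩ := h0
    rw [half_sum_log2Ratio_eq_top hl ht, rate_eq_top hμ hl (by rw [h.mse_eq, ht]; rfl)]

end IsGaussianAdditive

end GaussRD

/-! ### Existence: the forward channel. -/

namespace GaussRD

section GaussianFamily

variable {n : ℕ} {Ω : Type*} [MeasurableSpace Ω] {P : Measure Ω}

lemma memLp_eval_pi_gaussianReal (v : Fin n → ℝ≥0) (j : Fin n) :
    MemLp (fun z : Fin n → ℝ => z j) 2 (Measure.pi fun j => gaussianReal 0 (v j)) :=
  (memLp_id_gaussianReal' (μ := 0) (v := v j) 2 (by norm_num)).comp_measurePreserving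
    (measurePreserving_eval (fun j => gaussianReal 0 (v j)) j)

lemma covariance_eval_pi_gaussianReal (v : Fin n → ℝ≥0) (i j : Fin n) :
    cov[fun z : Fin n → ℝ => z i, fun z => z j; Measure.pi fun j => gaussianReal 0 (v j)]
      = if i = j then (v i : ℝ) else 0 := by
  split_ifs with hij
  · subst hij
    have h := (measurePreserving_eval (fun j => gaussianReal 0 (v j)) i).map_eq
    rw [covariance_self (measurable_pi_apply i).aemeasurable]
    have hv := variance_id_gaussianReal (μ := 0) (v := v i)
    rwa [← h, variance_map aemeasurable_id (measurable_pi_apply i).aemeasurable] at hv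
  · have hind : iIndepFun (fun i (z : Fin n → ℝ) => z i)
        (Measure.pi fun j => gaussianReal 0 (v j)) :=
      iIndepFun_pi (X := fun _ => id) fun _ => aemeasurable_id
    exact (hind.indepFun hij).covariance_eq_zero (memLp_eval_pi_gaussianReal v i)
      (memLp_eval_pi_gaussianReal v j)

instance isGaussian_pi_gaussianReal (v : Fin n → ℝ≥0) :
    IsGaussian (Measure.pi fun j => gaussianReal 0 (v j)) := by
  have hind : iIndepFun (fun i (z : Fin n → ℝ) => z i)
      (Measure.pi fun j => gaussianReal 0 (v j)) :=
    iIndepFun_pi (X := fun _ => id) fun _ => aemeasurable_id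
  have h := (hind.hasGaussianLaw fun j => ⟨by
    rw [(measurePreserving_eval (fun j => gaussianReal 0 (v j)) j).map_eq]
    infer_instance⟩).isGaussian_map
  rwa [show (fun (z : Fin n → ℝ) i => z i) = id from rfl, Measure.map_id] at h

lemma covariance_add_mul [IsProbabilityMeasure P] {X Y X' Y' : Ω → ℝ} (hX : MemLp X 2 P)
    (hY : MemLp Y 2 P) (hX' : MemLp X' 2 P) (hY' : MemLp Y' 2 P) (a b a' b' : ℝ) :
    cov[fun ω => a * X ω + b * Y ω, fun ω => a' * X' ω + b' * Y' ω; P]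
      = a * a' * cov[X, X'; P] + a * b' * cov[X, Y'; P] + b * a' * cov[Y, X'; P]
        + b * b' * cov[Y, Y'; P] := by
  have h := covariance_add_left (hX.const_mul a) (hY.const_mul b)
    ((hX'.const_mul a').add (hY'.const_mul b'))
  rw [covariance_add_right (hX.const_mul a) (hX'.const_mul a') (hY'.const_mul b'),
    covariance_add_right (hY.const_mul b) (hX'.const_mul a') (hY'.const_mul b')] at h
  simp only [covariance_const_mul_left, covariance_const_mul_right] at h
  refine h.trans ?_
  ring

end GaussianFamily

variable {n : ℕ} {μ : Measure (Vec n)} {lam θ : Fin n → ℝ≥0}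

lemma IsGaussianSource.map_components (hμ : IsGaussianSource μ lam) :
    μ.map (fun x j => x j) = Measure.pi fun j => gaussianReal 0 (lam j) := by
  rw [hμ.indep.map_fun_eq_pi_map fun j => by fun_prop]
  simp only [hμ.law]

/-- The gain `1 - θ / lam` of the forward channel. -/
noncomputable def gain (lam θ : Fin n → ℝ≥0) (j : Fin n) : ℝ≥0 := 1 - θ j / lam j

lemma coe_gain (hθ : ∀ j, θ j ≤ lam j) (j : Fin n) :
    (gain lam θ j : ℝ) = 1 - (θ j : ℝ) / lam j := by
  rw [gain, NNReal.coe_sub (div_le_one_of_le₀ (hθ j) zero_le)]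
  simp

/-- The one relation behind all triad covariances. If `λ_j = 0`, division by zero makes the gain 1,
harmlessly, since then `θ_j = 0`. -/
lemma gain_mul (hθ : ∀ j, θ j ≤ lam j) (j : Fin n) :
    (gain lam θ j : ℝ) * lam j = lam j - θ j := by
  rw [coe_gain hθ]
  by_cases hl : lam j = 0
  · have : θ j = 0 := le_antisymm (hl ▸ hθ j) zero_le
    simp [hl, this]
  · have : (lam j : ℝ) ≠ 0 := by exact_mod_cast hl
    field_simp

/-- The law of the noise of the forward channel. -/
noncomputable def forwardNoise (lam θ : Fin n → ℝ≥0) : Measure (Fin n → ℝ) :=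
  Measure.pi fun j => gaussianReal 0 (gain lam θ j * θ j)

instance (lam θ : Fin n → ℝ≥0) : IsGaussian (forwardNoise lam θ) :=
  isGaussian_pi_gaussianReal _

/-- The output of the forward channel for the input `q.1` and the noise `q.2`. -/
noncomputable def forwardMap (lam θ : Fin n → ℝ≥0) (q : Vec n × (Fin n → ℝ)) : Vec n :=
  WithLp.toLp 2 fun j => gain lam θ j * q.1 j + q.2 j

lemma measurable_forwardMap (lam θ : Fin n → ℝ≥0) : Measurable (forwardMap lam θ) :=
  (MeasurableEquiv.toLp 2 (Fin n → ℝ)).measurable.comp (by fun_prop)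

/-- The forward channel: each component is scaled by its gain, and independent Gaussian noise is
added. -/
noncomputable def forwardChannel (lam θ : Fin n → ℝ≥0) : Kernel (Vec n) (Vec n) :=
  (Kernel.id ×ₖ Kernel.const (Vec n) (forwardNoise lam θ)).map (forwardMap lam θ)

instance (lam θ : Fin n → ℝ≥0) : IsMarkovKernel (forwardChannel lam θ) :=
  Kernel.IsMarkovKernel.map _ (measurable_forwardMap lam θ)

lemma forwardChannel_apply (lam θ : Fin n → ℝ≥0) (x : Vec n) :
    forwardChannel lam θ x = (forwardNoise lam θ).map fun z => forwardMap lam θ (x, z) := by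
  rw [forwardChannel, Kernel.map_apply _ (measurable_forwardMap lam θ), Kernel.prod_apply,
    Kernel.id_apply, Kernel.const_apply, Measure.dirac_prod,
    Measure.map_map (measurable_forwardMap lam θ) (by fun_prop)]
  rfl

/-- Source components and channel noise, recovered from source and reconstruction. -/
noncomputable def sourceNoise (lam θ : Fin n → ℝ≥0) (p : Vec n × Vec n) :
    (Fin n → ℝ) × (Fin n → ℝ) :=
  (fun j => p.1 j, fun j => p.2 j - gain lam θ j * p.1 j)

lemma measurable_sourceNoise (lam θ : Fin n → ℝ≥0) : Measurable (sourceNoise lam θ) := by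
  unfold sourceNoise
  fun_prop

variable [IsProbabilityMeasure μ]

/-- Undoing the channel gives independent Gaussian coordinates; source, error and triads are linear
in them, so joint Gaussianity is automatic and only covariances need computing. -/
lemma map_sourceNoise (hμ : IsGaussianSource μ lam) :
    (μ ⊗ₘ forwardChannel lam θ).map (sourceNoise lam θ)
      = (Measure.pi fun j => gaussianReal 0 (lam j)).prod (forwardNoise lam θ) := by
  have hm := measurable_sourceNoise lam θ
  have h1 : (μ ⊗ₘ forwardChannel lam θ)
      = (μ.prod (forwardNoise lam θ)).map fun q => (q.1, forwardMap lam θ q) := by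
    ext s hs
    have hf := measurable_forwardMap lam θ
    have hpair : Measurable fun q : Vec n × (Fin n → ℝ) => (q.1, forwardMap lam θ q) :=
      measurable_fst.prodMk hf
    rw [Measure.compProd_apply hs, Measure.map_apply hpair hs, Measure.prod_apply (hpair hs)]
    refine lintegral_congr fun x => ?_
    have hfx : Measurable fun z => forwardMap lam θ (x, z) := hf.comp measurable_prodMk_left
    rw [forwardChannel_apply, Measure.map_apply hfx (measurable_prodMk_left hs)]
    rfl
  rw [h1, Measure.map_map hm (measurable_fst.prodMk (measurable_forwardMap lam θ)),
    ← hμ.map_components]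
  have h2 := Measure.map_prod_map μ (forwardNoise lam θ) (f := fun (x : Vec n) j => x j) (g := id)
    (by fun_prop) measurable_id
  rw [Measure.map_id] at h2
  rw [h2]
  congr 1
  ext q j <;> simp [sourceNoise, forwardMap]

section ForwardChannel

variable (θ)

lemma IsGaussianSource.hasGaussianLaw_sourceNoise (hμ : IsGaussianSource μ lam) :
    HasGaussianLaw (sourceNoise lam θ) (μ ⊗ₘ forwardChannel lam θ) :=
  ⟨by rw [map_sourceNoise hμ]; infer_instance⟩

lemma IsGaussianSource.memLp_source (hμ : IsGaussianSource μ lam) (j : Fin n) :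
    MemLp (fun p : Vec n × Vec n => p.1 j) 2 (μ ⊗ₘ forwardChannel lam θ) :=
  ((hμ.hasGaussianLaw_sourceNoise θ).map_fun
    (ContinuousLinearMap.proj (R := ℝ) (φ := fun _ : Fin n => ℝ) j ∘L
      ContinuousLinearMap.fst ℝ _ _)).memLp_two

lemma IsGaussianSource.memLp_noise (hμ : IsGaussianSource μ lam) (j : Fin n) :
    MemLp (fun p : Vec n × Vec n => p.2 j - gain lam θ j * p.1 j) 2
      (μ ⊗ₘ forwardChannel lam θ) :=
  ((hμ.hasGaussianLaw_sourceNoise θ).map_fun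
    (ContinuousLinearMap.proj (R := ℝ) (φ := fun _ : Fin n => ℝ) j ∘L
      ContinuousLinearMap.snd ℝ _ _)).memLp_two

lemma IsGaussianSource.cov_source (hμ : IsGaussianSource μ lam) (i j : Fin n) :
    cov[fun p : Vec n × Vec n => p.1 i, fun p => p.1 j; μ ⊗ₘ forwardChannel lam θ]
      = if i = j then (lam i : ℝ) else 0 := by
  have h : (μ ⊗ₘ forwardChannel lam θ).map (fun p => (sourceNoise lam θ p).1)
      = Measure.pi fun j => gaussianReal 0 (lam j) := by
    have := congrArg Measure.fst (map_sourceNoise (θ := θ) hμ)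
    rwa [Measure.fst_prod, Measure.fst, Measure.map_map measurable_fst
      (measurable_sourceNoise lam θ)] at this
  rw [← covariance_eval_pi_gaussianReal, ← h,
    covariance_map_fun (measurable_pi_apply i).aestronglyMeasurable
      (measurable_pi_apply j).aestronglyMeasurable (measurable_sourceNoise lam θ).fst.aemeasurable]
  rfl

lemma IsGaussianSource.map_noise (hμ : IsGaussianSource μ lam) :
    (μ ⊗ₘ forwardChannel lam θ).map (fun p => (sourceNoise lam θ p).2)
      = Measure.pi fun j => gaussianReal 0 (gain lam θ j * θ j) := by
  have := congrArg Measure.snd (map_sourceNoise (θ := θ) hμ)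
  rwa [Measure.snd_prod, Measure.snd, Measure.map_map measurable_snd
    (measurable_sourceNoise lam θ)] at this

lemma IsGaussianSource.cov_noise (hμ : IsGaussianSource μ lam) (i j : Fin n) :
    cov[fun p : Vec n × Vec n => p.2 i - gain lam θ i * p.1 i,
        fun p => p.2 j - gain lam θ j * p.1 j; μ ⊗ₘ forwardChannel lam θ]
      = if i = j then (gain lam θ i : ℝ) * θ i else 0 := by
  have h := hμ.map_noise θ
  have hc := covariance_eval_pi_gaussianReal (fun j => gain lam θ j * θ j) i j
  rw [← h, covariance_map_fun (measurable_pi_apply i).aestronglyMeasurable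
    (measurable_pi_apply j).aestronglyMeasurable (measurable_sourceNoise lam θ).snd.aemeasurable] at hc
  rw [NNReal.coe_mul] at hc
  exact hc

lemma IsGaussianSource.cov_source_noise (hμ : IsGaussianSource μ lam) (i j : Fin n) :
    cov[fun p : Vec n × Vec n => p.1 i, fun p => p.2 j - gain lam θ j * p.1 j;
      μ ⊗ₘ forwardChannel lam θ] = 0 := by
  have h := covariance_fst_snd_prod (memLp_eval_pi_gaussianReal lam i)
    (memLp_eval_pi_gaussianReal (fun j => gain lam θ j * θ j) j)
  rw [← forwardNoise] at h
  rwa [← map_sourceNoise hμ, covariance_map_fun (by fun_prop) (by fun_prop)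
    (measurable_sourceNoise lam θ).aemeasurable] at h

/-- The coefficients of the source component and of the noise in the triad. -/
noncomputable def triadCoeff (lam θ : Fin n → ℝ≥0) (j : Fin n) : Fin 3 → ℝ × ℝ :=
  ![(gain lam θ j, 1), (1, 0), (gain lam θ j - 1, 1)]

lemma triad_eq (j : Fin n) (k : Fin 3) (p : Vec n × Vec n) :
    triad j p k = (triadCoeff lam θ j k).1 * p.1 j
      + (triadCoeff lam θ j k).2 * (p.2 j - gain lam θ j * p.1 j) := by
  fin_cases k <;> simp [triad, triadCoeff]; ring

lemma IsGaussianSource.cov_triad (hμ : IsGaussianSource μ lam) (i j : Fin n) (k l : Fin 3) :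
    cov[fun p => triad i p k, fun p => triad j p l; μ ⊗ₘ forwardChannel lam θ]
      = if i = j then (triadCoeff lam θ i k).1 * (triadCoeff lam θ i l).1 * lam i
        + (triadCoeff lam θ i k).2 * (triadCoeff lam θ i l).2 * (gain lam θ i * θ i) else 0 := by
  simp only [triad_eq (lam := lam) θ]
  rw [covariance_add_mul (hμ.memLp_source θ i) (hμ.memLp_noise θ i) (hμ.memLp_source θ j)
    (hμ.memLp_noise θ j), hμ.cov_source, hμ.cov_noise, hμ.cov_source_noise, covariance_comm,
    hμ.cov_source_noise]
  split_ifs with hij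
  · subst hij; ring
  · ring

/-- The forward channel is a Gaussian-additive encoding. -/
lemma IsGaussianSource.isGaussianAdditive_forwardChannel (hμ : IsGaussianSource μ lam)
    (hθ : ∀ j, θ j ≤ lam j) : IsGaussianAdditive μ (forwardChannel lam θ) lam θ where
  gaussian := by
    let e := (PiLp.continuousLinearEquiv 2 ℝ fun _ : Fin n => ℝ).symm.toContinuousLinearMap
    let X : (Fin n → ℝ) × (Fin n → ℝ) →L[ℝ] (Fin n → ℝ) := ContinuousLinearMap.fst ℝ _ _
    let Z : (Fin n → ℝ) × (Fin n → ℝ) →L[ℝ] (Fin n → ℝ) := ContinuousLinearMap.snd ℝ _ _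
    let D : (Fin n → ℝ) × (Fin n → ℝ) →L[ℝ] (Fin n → ℝ) := ContinuousLinearMap.pi fun j =>
      ((gain lam θ j : ℝ) - 1) • (ContinuousLinearMap.proj j ∘L X) + ContinuousLinearMap.proj j ∘L Z
    refine ((hμ.hasGaussianLaw_sourceNoise θ).map_fun ((e ∘L X).prod (e ∘L D))).congr
      (Filter.Eventually.of_forall fun p => ?_)
    ext j
    · simp [e, X, sourceNoise]
    · simp [e, X, Z, D, sourceNoise]; ring
  zero_mean j := by
    have hG := hμ.map_compProd (κ := forwardChannel lam θ) j
    have h1 : ∫ p : Vec n × Vec n, p.1 j ∂(μ ⊗ₘ forwardChannel lam θ) = 0 := by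
      have := integral_id_gaussianReal (μ := 0) (v := lam j)
      rwa [← hG, integral_map (by fun_prop) (by fun_prop)] at this
    have h2 : ∫ p : Vec n × Vec n, (p.2 j - gain lam θ j * p.1 j)
        ∂(μ ⊗ₘ forwardChannel lam θ) = 0 := by
      have hev := congrArg (fun ν => ∫ z, z j ∂ν) (hμ.map_noise θ)
      rw [integral_map (measurable_sourceNoise lam θ).snd.aemeasurable
        (measurable_pi_apply j).aestronglyMeasurable] at hev
      refine hev.trans ?_
      have hpi := (measurePreserving_eval (fun j => gaussianReal 0 (gain lam θ j * θ j)) j).map_eq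
      have := integral_id_gaussianReal (μ := 0) (v := gain lam θ j * θ j)
      rwa [← hpi, integral_map (measurable_pi_apply j).aemeasurable (by fun_prop)] at this
    -- The error is `(gain - 1) * x_j + z_j`, a combination of centered variables.
    have hi1 := ((hμ.memLp_source θ j).integrable one_le_two).const_mul ((gain lam θ j : ℝ) - 1)
    have hi2 := (hμ.memLp_noise θ j).integrable one_le_two
    have hsum := integral_add hi1 hi2
    rw [integral_const_mul, h1, h2, mul_zero, add_zero] at hsum
    rw [← hsum]
    exact integral_congr_ae (Filter.Eventually.of_forall fun p => by ring)
  indep := by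
    have hG : HasGaussianLaw (fun p (i : Fin n) (k : Fin 3) => triad i p k)
        (μ ⊗ₘ forwardChannel lam θ) := by
      let L : (Fin n → ℝ) × (Fin n → ℝ) →L[ℝ] (Fin n → Fin 3 → ℝ) :=
        ContinuousLinearMap.pi fun j => ContinuousLinearMap.pi fun k =>
          (triadCoeff lam θ j k).1 • (ContinuousLinearMap.proj j ∘L ContinuousLinearMap.fst ℝ _ _)
          + (triadCoeff lam θ j k).2 •
            (ContinuousLinearMap.proj j ∘L ContinuousLinearMap.snd ℝ _ _)
      refine ((hμ.hasGaussianLaw_sourceNoise θ).map_fun L).congr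
        (Filter.Eventually.of_forall fun p => ?_)
      ext j k
      simp [L, triad_eq (lam := lam) θ, sourceNoise]
    refine hG.iIndepFun_of_covariance_eval (X := fun i k p => triad i p k) fun i j hij k l => ?_
    rw [hμ.cov_triad, if_neg hij]
  cov_triad j := by
    have hg := gain_mul hθ j
    ext k l
    rw [Matrix.of_apply, hμ.cov_triad, if_pos rfl]
    -- Noise variance `gain * θ_j` makes the error variance `(1 - gain)² λ_j + gain * θ_j = θ_j`;
    -- each nontrivial entry follows from a multiple of `gain_mul`.
    fin_cases k <;> fin_cases l <;> simp [triadCoeff] <;>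
      first
      | linear_combination hg
      | linear_combination (gain lam θ j : ℝ) * hg
      | linear_combination ((gain lam θ j : ℝ) + 1) * hg
      | linear_combination ((gain lam θ j : ℝ) - 1) * hg

end ForwardChannel

end GaussRD

theorem lemma1 {n : ℕ} (μ : Measure (GaussRD.Vec n)) [IsProbabilityMeasure μ]
    (lam θ : Fin n → ℝ≥0) (hμ : GaussRD.IsGaussianSource μ lam) (hθ : ∀ j, θ j ≤ lam j) :
    -- Gaussian-additive encodings with error variances `θ` exist;
    (∃ κ : Kernel (GaussRD.Vec n) (GaussRD.Vec n),
      IsMarkovKernel κ ∧ GaussRD.IsGaussianAdditive μ κ lam θ) ∧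
    -- each of them has the stated rate, component errors and distortion;
    (∀ κ : Kernel (GaussRD.Vec n) (GaussRD.Vec n), IsMarkovKernel κ →
      GaussRD.IsGaussianAdditive μ κ lam θ →
        GaussRD.rate μ κ = 1 / 2 * ∑ j, GaussRD.log2Ratio (lam j) (θ j) ∧
        (∀ j, GaussRD.mse μ κ j = θ j) ∧
        GaussRD.distortion μ κ = ∑ j, (θ j : ℝ≥0∞)) ∧
    -- that rate is the minimum over all encodings with these component errors;
    IsLeast {R : ℝ≥0∞ | ∃ κ : Kernel (GaussRD.Vec n) (GaussRD.Vec n),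
        IsMarkovKernel κ ∧ (∀ j, GaussRD.mse μ κ j = θ j) ∧ GaussRD.rate μ κ = R}
      (1 / 2 * ∑ j, GaussRD.log2Ratio (lam j) (θ j)) ∧
    -- and every encoding with these component errors has the stated distortion.
    (∀ κ : Kernel (GaussRD.Vec n) (GaussRD.Vec n), IsMarkovKernel κ →
      (∀ j, GaussRD.mse μ κ j = θ j) →
        GaussRD.distortion μ κ = ∑ j, (θ j : ℝ≥0∞)) := by
  have hdist : ∀ κ : Kernel (GaussRD.Vec n) (GaussRD.Vec n), (∀ j, GaussRD.mse μ κ j = θ j) →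
      GaussRD.distortion μ κ = ∑ j, (θ j : ℝ≥0∞) := fun κ h => by
    rw [GaussRD.distortion_eq_sum_mse, Finset.sum_congr rfl fun j _ => h j]
  have hadd := hμ.isGaussianAdditive_forwardChannel θ hθ
  refine ⟨⟨GaussRD.forwardChannel lam θ, inferInstance, hadd⟩,
    fun κ _ h => ⟨h.rate_eq hμ hθ, h.mse_eq, hdist κ h.mse_eq⟩,
    ⟨⟨GaussRD.forwardChannel lam θ, inferInstance, hadd.mse_eq, hadd.rate_eq hμ hθ⟩, ?_⟩,
    fun κ _ h => hdist κ h⟩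
  rintro R ⟨κ, _, h, rfl⟩
  by_cases h0 : ∀ j, θ j = 0 → lam j = 0
  · exact GaussRD.rate_lower_bound hμ hθ h0 h
  · push Not at h0
    obtain ⟨j, ht, hl⟩ := h0
    rw [GaussRD.rate_eq_top hμ hl (by rw [h, ht]; rfl)]
    exact le_top
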